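/- Write $z=(x,y)\in\mathbb R^2$, $|z|^2=x^2+y^2$, and let $u:\mathbb R^2\to\mathbb R^3$ be the degree-one bubble $$u(x,y)=\left(\frac{2x}{1+|z|^2},\ \frac{2y}{1+|z|^2},\ \frac{|z|^2-1}{|z|^2+1}\right).$$ Let $\mathbb K$ be $\mathbb R$ or $\mathbb C$, and let $\wedge$ denote the ($\mathbb K$-bilinear) vector cross product on $\mathbb K^3$. **Theorem 1.2.** For no $\lambda\in\mathbb K$ is there a function $w:\mathbb R^2\to\mathbb K^3$ of class $C^2$, not identically zero, with $w\in L^2(\mathbb R^2)$ (with respect to Lebesgue measure $dx\,dy$), which satisfies $$\Delta w = 2\,(w_x\wedge u_y+u_x\wedge w_y)+\frac{4\lambda}{(1+|z|^2)^2}\,w\qquad\text{on }\mathbb R^2$$ and which is co-rotational, that is, which has in polar coordinates $(r,\theta)$, $r>0$, the form $$w(r,\theta)=\bigl(f(r)\cos\theta,\ f(r)\sin\theta,\ g(r)\bigr)$$ for some functions $f,g:(0,\infty)\to\mathbb K$. -/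

import Mathlib

open scoped Laplacian Matrix

noncomputable section

/-- The partial derivative in the `i`-th coordinate direction of the plane
(`i = 0` is `∂/∂x`, `i = 1` is `∂/∂y`). -/
def partialDeriv {F : Type*} [NormedAddCommGroup F] [NormedSpace ℝ F] (i : Fin 2)
    (w : EuclideanSpace ℝ (Fin 2) → F) (p : EuclideanSpace ℝ (Fin 2)) : F :=
  fderiv ℝ w p (EuclideanSpace.single i 1)

/-- The vector cross product on `𝕜³` (bilinear for `𝕜 = ℂ`). -/
def cross {𝕜 : Type*} [RCLike 𝕜] (a b : EuclideanSpace 𝕜 (Fin 3)) : EuclideanSpace 𝕜 (Fin 3) :=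
  WithLp.toLp 2 (a.ofLp ⨯₃ b.ofLp)

/-- The degree one bubble
`(x, y) ↦ (2x / (1 + |z|²), 2y / (1 + |z|²), (|z|² - 1) / (|z|² + 1))`,
with its real values regarded as elements of `𝕜³`. -/
def degreeOneBubble (𝕜 : Type*) [RCLike 𝕜] (p : EuclideanSpace ℝ (Fin 2)) :
    EuclideanSpace 𝕜 (Fin 3) :=
  !₂[((2 * p 0 / (1 + ‖p‖ ^ 2) : ℝ) : 𝕜),
     ((2 * p 1 / (1 + ‖p‖ ^ 2) : ℝ) : 𝕜),
     (((‖p‖ ^ 2 - 1) / (‖p‖ ^ 2 + 1) : ℝ) : 𝕜)]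

/-- `w` solves, at every point of the plane,
`Δw = 2 (w_x ∧ u_y + u_x ∧ w_y) + 4λ / (1 + |z|²)² w`. -/
def SolvesEigenvalueEquation {𝕜 : Type*} [RCLike 𝕜]
    (u : EuclideanSpace ℝ (Fin 2) → EuclideanSpace 𝕜 (Fin 3)) (lam : 𝕜)
    (w : EuclideanSpace ℝ (Fin 2) → EuclideanSpace 𝕜 (Fin 3)) : Prop :=
  ∀ p : EuclideanSpace ℝ (Fin 2),
    Δ w p =
      (2 : 𝕜) • (cross (partialDeriv 0 w p) (partialDeriv 1 u p)
        + cross (partialDeriv 0 u p) (partialDeriv 1 w p))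
      + (4 * lam / (((1 + ‖p‖ ^ 2) ^ 2 : ℝ) : 𝕜)) • w p

/-- `w` is an eigenfunction with eigenvalue `lam` of the equation linearized at `u`: a nonzero
classical solution of the eigenvalue equation that is in `L²` for Lebesgue measure on the plane. -/
structure IsEigenfunction {𝕜 : Type*} [RCLike 𝕜]
    (u : EuclideanSpace ℝ (Fin 2) → EuclideanSpace 𝕜 (Fin 3)) (lam : 𝕜)
    (w : EuclideanSpace ℝ (Fin 2) → EuclideanSpace 𝕜 (Fin 3)) : Prop where
  contDiff : ContDiff ℝ 2 w
  solves : SolvesEigenvalueEquation u lam w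
  memLp : MeasureTheory.MemLp w 2 MeasureTheory.volume
  ne_zero : w ≠ 0

/-- `w` is co-rotational of degree `m`: in polar coordinates
`w(r, θ) = (f(r) cos mθ, f(r) sin mθ, g(r))` for some functions `f`, `g` of `r > 0`. -/
def IsCorotational {𝕜 : Type*} [RCLike 𝕜] (m : ℕ)
    (w : EuclideanSpace ℝ (Fin 2) → EuclideanSpace 𝕜 (Fin 3)) : Prop :=
  ∃ f g : ℝ → 𝕜, ∀ r θ : ℝ, 0 < r →
    w !₂[r * Real.cos θ, r * Real.sin θ] =
      !₂[f r * ((Real.cos (m * θ) : ℝ) : 𝕜), f r * ((Real.sin (m * θ) : ℝ) : 𝕜), g r]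

end

/-!
Along a co-rotational solution put `r = eᵗ` and `φ = 2r / (1 + r²) = 1 / cosh t`. Since
`e²ᵗ Δ = ∂ₜ² + ∂_θ²` and `e²ᵗ (w_x ∧ u_y + u_x ∧ w_y) = w_t ∧ u_θ + u_t ∧ w_θ`, the eigenvalue
equation, read at `θ = 0`, becomes for the profiles `f`, `g` as functions of `t`

  `f'' - f = -2 φ g' + (λ - 2) φ² f`,  `g'' = 2 (φ f)' + λ φ² g`.

With `G = g' - 2 φ f` this is a first-order linear system for `(f, f', G, g)` whose coefficients
converge to a constant matrix with eigenvalues `1, -1, 0, 0`, with an error `O(φ)`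
(`SolvesEigenvalueEquation.isProfileSystem`). Hence no nonzero solution decays faster than `e⁻ᵗ`,
while `w ∈ L²` means `∫ e²ᵗ (|f|² + |g|²) dt < ∞` (`IsCorotational.integrable_of_memLp`); the value of
`λ` plays no role, and regularity at the origin is not needed.

The argument is quantitative. The energy `E = e²ᵗ (|f|² + |f'|² + |g|² + |G|²)` satisfies
`E' ≥ -K φ E` with `φ` integrable, so, if it is positive at some time, it is bounded below from then
on by some `c > 0` (`IsProfileSystem.exists_pos_le_weightedEnergy`). Let
`a = e²ᵗ (|f|² + |g|²)` and `b = e²ᵗ (⟨f, f'⟩ + ⟨g, G⟩)`. Then `b' ≥ E / 2 - C a` and `a' ≥ 2 b`. As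
`a` is integrable, the first inequality gives `b → ∞`, the second `a → ∞`: a contradiction
(`IsProfileSystem.eq_zero_of_integrable`).
-/

/-! ### The linear system satisfied by the radial profiles -/

/-- The function `t ↦ 2eᵗ / (1 + e²ᵗ) = 1 / cosh t`: the length of the horizontal part of the degree
one bubble on the circle of radius `eᵗ`. -/
noncomputable def bubbleProfile (t : ℝ) : ℝ := 2 * Real.exp t / (1 + Real.exp t ^ 2)

lemma bubbleProfile_pos (t : ℝ) : 0 < bubbleProfile t := by
  unfold bubbleProfile; positivity

lemma bubbleProfile_le_one (t : ℝ) : bubbleProfile t ≤ 1 := by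
  unfold bubbleProfile
  rw [div_le_one (by positivity)]
  nlinarith [sq_nonneg (Real.exp t - 1)]

lemma hasDerivAt_two_mul_arctan_exp (t : ℝ) :
    HasDerivAt (fun s => 2 * Real.arctan (Real.exp s)) (bubbleProfile t) t := by
  have h := ((Real.hasDerivAt_exp t).arctan).const_mul 2
  have e : bubbleProfile t = 2 * (1 / (1 + Real.exp t ^ 2) * Real.exp t) := by
    unfold bubbleProfile
    ring
  rwa [e]

/-- The first-order linear system, in the variable `t = log r`, satisfied by the profiles `f`, `g` of
a co-rotational solution, by `k = f'` and by `G = g' - 2 φ f`, where `φ = 1 / cosh`. With the unknown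
`G` in place of `g'`, no derivative occurs on the right-hand sides. The map `L` stands for
multiplication by the eigenvalue. -/
structure IsProfileSystem {E : Type*} [NormedAddCommGroup E] [NormedSpace ℝ E]
    (L : E → E) (f k g G : ℝ → E) : Prop where
  hasDerivAt_f : ∀ t, HasDerivAt f (k t) t
  hasDerivAt_k : ∀ t, HasDerivAt k
    (f t - (2 * bubbleProfile t) • G t + bubbleProfile t ^ 2 • (L (f t) - (6 : ℝ) • f t)) t
  hasDerivAt_g : ∀ t, HasDerivAt g (G t + (2 * bubbleProfile t) • f t) t
  hasDerivAt_G : ∀ t, HasDerivAt G (bubbleProfile t ^ 2 • L (g t)) t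

section Growth

variable {E : Type*} [NormedAddCommGroup E] [InnerProductSpace ℝ E] {L : E → E} {ℓ : ℝ}
  {f k g G : ℝ → E}

lemma abs_inner_le_half_sq_add_sq (x y : E) : |inner ℝ x y| ≤ (‖x‖ ^ 2 + ‖y‖ ^ 2) / 2 := by
  nlinarith [abs_real_inner_le_norm x y, sq_nonneg (‖x‖ - ‖y‖)]

lemma abs_inner_map_le (hL : ∀ x, ‖L x‖ ≤ ℓ * ‖x‖) (hℓ : 0 ≤ ℓ) (x y : E) :
    |inner ℝ (L x) y| ≤ ℓ * ((‖x‖ ^ 2 + ‖y‖ ^ 2) / 2) := by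
  have h1 := abs_real_inner_le_norm (L x) y
  have h2 := mul_le_mul_of_nonneg_right (hL x) (norm_nonneg y)
  have h3 := mul_nonneg hℓ (sq_nonneg (‖x‖ - ‖y‖))
  nlinarith

/-- The weighted energy `e²ᵗ (|f|² + |k|² + |g|² + |G|²)` of a solution of the profile system. -/
noncomputable def weightedEnergy (f k g G : ℝ → E) (t : ℝ) : ℝ :=
  Real.exp t ^ 2 * (‖f t‖ ^ 2 + ‖k t‖ ^ 2 + (‖g t‖ ^ 2 + ‖G t‖ ^ 2))

lemma hasDerivAt_exp_sq (t : ℝ) :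
    HasDerivAt (fun s => Real.exp s ^ 2) (2 * Real.exp t ^ 2) t := by
  refine ((Real.hasDerivAt_exp t).pow 2).congr_deriv ?_
  push_cast
  ring

/-- The derivative of the weighted energy is at least `-K φ` times the energy. The weight `e²ᵗ` shifts
the exponents `1, -1, 0, 0` of the limiting constant system to `2, 0, 1, 1`, so that the constant
part contributes the nonnegative form `2 |f + k|² + 2 (|g|² + ⟨G, g⟩ + |G|²)`; everything else carries
a factor `φ`. -/
lemma IsProfileSystem.exists_deriv_weightedEnergy_ge (h : IsProfileSystem L f k g G)
    (hL : ∀ x, ‖L x‖ ≤ ℓ * ‖x‖) (hℓ : 0 ≤ ℓ) (t : ℝ) :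
    ∃ D, HasDerivAt (weightedEnergy f k g G) D t ∧
      -(10 + 2 * ℓ) * bubbleProfile t * weightedEnergy f k g G t ≤ D := by
  refine ⟨_, (hasDerivAt_exp_sq t).mul (((h.hasDerivAt_f t).norm_sq.add
    (h.hasDerivAt_k t).norm_sq).add ((h.hasDerivAt_g t).norm_sq.add
    (h.hasDerivAt_G t).norm_sq)), ?_⟩
  have hφ := bubbleProfile_pos t
  have hφ1 := bubbleProfile_le_one t
  set φ := bubbleProfile t
  simp only [inner_add_right, inner_sub_right, real_inner_smul_right, weightedEnergy]
  rw [real_inner_comm (f t) (k t), real_inner_comm (L (f t)) (k t),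
    real_inner_comm (L (g t)) (G t)]
  have e1 := abs_le.1 (abs_inner_le_half_sq_add_sq (k t) (G t))
  have e2 := abs_le.1 (abs_inner_map_le hL hℓ (f t) (k t))
  have e3 := abs_le.1 (abs_inner_le_half_sq_add_sq (f t) (k t))
  have e4 := abs_le.1 (abs_inner_le_half_sq_add_sq (g t) (f t))
  have e5 := abs_le.1 (abs_inner_map_le hL hℓ (g t) (G t))
  have e6 := abs_le.1 (abs_inner_le_half_sq_add_sq (g t) (G t))
  have hsq : φ ^ 2 ≤ φ := by nlinarith
  have pos : 0 < φ ^ 2 := by positivity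
  have pe : 0 < Real.exp t ^ 2 := by positivity
  generalize Real.exp t ^ 2 = ex at *
  generalize inner ℝ (k t) (G t) = i1 at *
  generalize inner ℝ (L (f t)) (k t) = i2 at *
  generalize inner ℝ (f t) (k t) = i3 at *
  generalize inner ℝ (g t) (f t) = i4 at *
  generalize inner ℝ (L (g t)) (G t) = i5 at *
  generalize inner ℝ (g t) (G t) = i6 at *
  have a1 : 0 ≤ ‖f t‖ ^ 2 := by positivity
  have a2 : 0 ≤ ‖k t‖ ^ 2 := by positivity
  have a3 : 0 ≤ ‖g t‖ ^ 2 := by positivity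
  have a4 : 0 ≤ ‖G t‖ ^ 2 := by positivity
  generalize ‖f t‖ ^ 2 = A at *
  generalize ‖k t‖ ^ 2 = B at *
  generalize ‖g t‖ ^ 2 = C at *
  generalize ‖G t‖ ^ 2 = D at *
  have m1 := mul_le_mul_of_nonneg_left e1.2 hφ.le
  have m2 := mul_le_mul_of_nonneg_left e2.1 pos.le
  have m3 := mul_le_mul_of_nonneg_left e3.2 pos.le
  have m4 := mul_le_mul_of_nonneg_left e4.1 hφ.le
  have m5 := mul_le_mul_of_nonneg_left e5.1 pos.le
  have n1 := mul_le_mul_of_nonneg_right hsq (add_nonneg a1 a2)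
  have n2 := mul_le_mul_of_nonneg_right hsq (mul_nonneg hℓ (add_nonneg a1 a2))
  have n3 := mul_le_mul_of_nonneg_right hsq (mul_nonneg hℓ (add_nonneg a3 a4))
  have q1 := mul_nonneg (mul_nonneg hφ.le hℓ) a1
  have q2 := mul_nonneg (mul_nonneg hφ.le hℓ) a2
  have q3 := mul_nonneg (mul_nonneg hφ.le hℓ) a3
  have q4 := mul_nonneg (mul_nonneg hφ.le hℓ) a4
  have r1 := mul_nonneg hφ.le a1
  have r2 := mul_nonneg hφ.le a2
  have r3 := mul_nonneg hφ.le a3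
  have r4 := mul_nonneg hφ.le a4
  have key : 0 ≤ 2 * (A + B + (C + D)) + (2 * i3 + 2 * (i3 - 2 * φ * i1 + φ ^ 2 * (i2 - 6 * i3)) +
      (2 * (i6 + 2 * φ * i4) + 2 * (φ ^ 2 * i5))) + (10 + 2 * ℓ) * φ * (A + B + (C + D)) := by
    linarith [e3.1, e6.1]
  have := mul_nonneg pe.le key
  linarith

lemma IsProfileSystem.weightedEnergy_mul_exp_monotone (h : IsProfileSystem L f k g G)
    (hL : ∀ x, ‖L x‖ ≤ ℓ * ‖x‖) (hℓ : 0 ≤ ℓ) :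
    Monotone fun t => weightedEnergy f k g G t *
      Real.exp ((10 + 2 * ℓ) * (2 * Real.arctan (Real.exp t))) := by
  choose D hD hDge using h.exists_deriv_weightedEnergy_ge hL hℓ
  have hd : ∀ t, HasDerivAt (fun t => weightedEnergy f k g G t *
      Real.exp ((10 + 2 * ℓ) * (2 * Real.arctan (Real.exp t)))) _ t := fun t =>
    (hD t).mul ((hasDerivAt_two_mul_arctan_exp t).const_mul (10 + 2 * ℓ)).exp
  refine monotone_of_deriv_nonneg (fun t => (hd t).differentiableAt) fun t => ?_
  rw [(hd t).deriv]
  have := mul_nonneg (sub_nonneg.2 (hDge t))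
    (Real.exp_pos ((10 + 2 * ℓ) * (2 * Real.arctan (Real.exp t)))).le
  linarith

/-- If the weighted energy is positive at one time, it stays bounded below by a positive constant
from then on, because `φ` is integrable. -/
lemma IsProfileSystem.exists_pos_le_weightedEnergy (h : IsProfileSystem L f k g G)
    (hL : ∀ x, ‖L x‖ ≤ ℓ * ‖x‖) (hℓ : 0 ≤ ℓ) {t₀ : ℝ} (h0 : 0 < weightedEnergy f k g G t₀) :
    ∃ c > 0, ∀ t ≥ t₀, c ≤ weightedEnergy f k g G t := by
  refine ⟨weightedEnergy f k g G t₀ * Real.exp (-((10 + 2 * ℓ) * Real.pi)), by positivity,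
    fun t ht => ?_⟩
  have hm := h.weightedEnergy_mul_exp_monotone hL hℓ ht
  have h1 : (1 : ℝ) ≤ Real.exp ((10 + 2 * ℓ) * (2 * Real.arctan (Real.exp t₀))) := by
    apply Real.one_le_exp
    have := Real.arctan_pos.2 (Real.exp_pos t₀)
    positivity
  have h2 : Real.exp ((10 + 2 * ℓ) * (2 * Real.arctan (Real.exp t))) ≤
      Real.exp ((10 + 2 * ℓ) * Real.pi) := by
    apply Real.exp_le_exp.2
    have := Real.arctan_lt_pi_div_two (Real.exp t)
    apply mul_le_mul_of_nonneg_left _ (by positivity)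
    linarith
  have hE : 0 ≤ weightedEnergy f k g G t := by unfold weightedEnergy; positivity
  rw [Real.exp_neg, ← div_eq_mul_inv, div_le_iff₀ (Real.exp_pos _)]
  calc weightedEnergy f k g G t₀ ≤ _ := le_mul_of_one_le_right h0.le h1
    _ ≤ _ := hm
    _ ≤ _ := mul_le_mul_of_nonneg_left h2 hE

/-- The virial quantity `b = e²ᵗ (⟨f, k⟩ + ⟨g, G⟩)` grows at least at the rate
`E / 2 - C e²ᵗ (|f|² + |g|²)`, where `E` is the weighted energy. -/
lemma IsProfileSystem.exists_deriv_virial_ge (h : IsProfileSystem L f k g G)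
    (hL : ∀ x, ‖L x‖ ≤ ℓ * ‖x‖) (hℓ : 0 ≤ ℓ) (t : ℝ) :
    ∃ D, HasDerivAt (fun t => Real.exp t ^ 2 * (inner ℝ (f t) (k t) + inner ℝ (g t) (G t))) D t ∧
      weightedEnergy f k g G t / 2
        - (10 + ℓ) * (Real.exp t ^ 2 * (‖f t‖ ^ 2 + ‖g t‖ ^ 2)) ≤ D := by
  refine ⟨_, (hasDerivAt_exp_sq t).mul (((h.hasDerivAt_f t).inner ℝ (h.hasDerivAt_k t)).add
    ((h.hasDerivAt_g t).inner ℝ (h.hasDerivAt_G t))), ?_⟩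
  have hφ := bubbleProfile_pos t
  have hφ1 := bubbleProfile_le_one t
  set φ := bubbleProfile t
  simp only [inner_add_right, inner_sub_right, real_inner_smul_right, weightedEnergy,
    inner_add_left, real_inner_smul_left, real_inner_self_eq_norm_sq]
  rw [real_inner_comm (L (f t)) (f t), real_inner_comm (L (g t)) (g t)]
  have e1 := abs_le.1 (abs_inner_map_le hL hℓ (f t) (f t))
  have e2 := abs_le.1 (abs_inner_map_le hL hℓ (g t) (g t))
  have e3 : -(‖k t‖ ^ 2 / 2 + 2 * ‖f t‖ ^ 2) ≤ 2 * inner ℝ (f t) (k t) := by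
    have := (abs_le.1 (abs_real_inner_le_norm (f t) (k t))).1
    nlinarith [sq_nonneg (‖k t‖ - 2 * ‖f t‖)]
  have e4 : -(‖G t‖ ^ 2 / 2 + 2 * ‖g t‖ ^ 2) ≤ 2 * inner ℝ (g t) (G t) := by
    have := (abs_le.1 (abs_real_inner_le_norm (g t) (G t))).1
    nlinarith [sq_nonneg (‖G t‖ - 2 * ‖g t‖)]
  have hsq : φ ^ 2 ≤ 1 := by nlinarith
  have pos : 0 < φ ^ 2 := by positivity
  have pe : 0 < Real.exp t ^ 2 := by positivity
  generalize Real.exp t ^ 2 = ex at *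
  generalize inner ℝ (L (f t)) (f t) = i1 at *
  generalize inner ℝ (L (g t)) (g t) = i2 at *
  generalize inner ℝ (f t) (k t) = i3 at *
  generalize inner ℝ (g t) (G t) = i4 at *
  generalize inner ℝ (f t) (G t) = i5 at *
  have a1 : 0 ≤ ‖f t‖ ^ 2 := by positivity
  have a2 : 0 ≤ ‖k t‖ ^ 2 := by positivity
  have a3 : 0 ≤ ‖g t‖ ^ 2 := by positivity
  have a4 : 0 ≤ ‖G t‖ ^ 2 := by positivity
  generalize ‖f t‖ ^ 2 = A at *
  generalize ‖k t‖ ^ 2 = B at *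
  generalize ‖g t‖ ^ 2 = C at *
  generalize ‖G t‖ ^ 2 = D at *
  have m1 := mul_le_mul_of_nonneg_left e1.1 pos.le
  have m2 := mul_le_mul_of_nonneg_left e2.1 pos.le
  have n1 := mul_le_mul_of_nonneg_right hsq a1
  have n2 := mul_le_mul_of_nonneg_right hsq (mul_nonneg hℓ a1)
  have n3 := mul_le_mul_of_nonneg_right hsq (mul_nonneg hℓ a3)
  have key : 0 ≤ 2 * (i3 + i4) + (A - 2 * φ * i5 + φ ^ 2 * (i1 - 6 * A) + B + (φ ^ 2 * i2 +
      (D + 2 * φ * i5))) - (A + B + (C + D)) / 2 + (10 + ℓ) * (A + C) := by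
    linarith
  have := mul_nonneg pe.le key
  linarith

lemma IsProfileSystem.exists_deriv_mass_ge (h : IsProfileSystem L f k g G) (t : ℝ) :
    ∃ D, HasDerivAt (fun t => Real.exp t ^ 2 * (‖f t‖ ^ 2 + ‖g t‖ ^ 2)) D t ∧
      2 * (Real.exp t ^ 2 * (inner ℝ (f t) (k t) + inner ℝ (g t) (G t))) ≤ D := by
  refine ⟨_, (hasDerivAt_exp_sq t).mul
    ((h.hasDerivAt_f t).norm_sq.add (h.hasDerivAt_g t).norm_sq), ?_⟩
  simp only [inner_add_right, real_inner_smul_right]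
  have e4 := abs_le.1 (abs_inner_le_half_sq_add_sq (g t) (f t))
  have m := mul_le_mul_of_nonneg_left e4.1 (bubbleProfile_pos t).le
  have n := mul_le_mul_of_nonneg_right (bubbleProfile_le_one t)
    (add_nonneg (sq_nonneg ‖g t‖) (sq_nonneg ‖f t‖))
  have := mul_nonneg (sq_nonneg (Real.exp t)) (show 0 ≤ 2 * (‖f t‖ ^ 2 + ‖g t‖ ^ 2) +
    4 * bubbleProfile t * inner ℝ (g t) (f t) by linarith)
  linarith

open MeasureTheory Filter in
/-- A solution of the profile system that is square integrable with the weight `e²ᵗ` vanishes. -/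
theorem IsProfileSystem.eq_zero_of_integrable (h : IsProfileSystem L f k g G)
    (hL : ∀ x, ‖L x‖ ≤ ℓ * ‖x‖) (hℓ : 0 ≤ ℓ)
    (hint : Integrable fun t => Real.exp t ^ 2 * (‖f t‖ ^ 2 + ‖g t‖ ^ 2)) (t₀ : ℝ) :
    f t₀ = 0 ∧ g t₀ = 0 := by
  by_contra hne
  have h0 : 0 < weightedEnergy f k g G t₀ := by
    unfold weightedEnergy
    rw [not_and_or] at hne
    rcases hne with hne | hne
    · have := norm_pos_iff.2 hne
      positivity
    · have := norm_pos_iff.2 hne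
      positivity
  obtain ⟨c, hc, hcE⟩ := h.exists_pos_le_weightedEnergy hL hℓ h0
  choose D hD hDge using h.exists_deriv_virial_ge hL hℓ
  choose D' hD' hDge' using h.exists_deriv_mass_ge
  set a : ℝ → ℝ := fun t => Real.exp t ^ 2 * (‖f t‖ ^ 2 + ‖g t‖ ^ 2) with ha
  set b : ℝ → ℝ := fun t => Real.exp t ^ 2 * (inner ℝ (f t) (k t) + inner ℝ (g t) (G t)) with hb
  have ha0 : ∀ t, 0 ≤ a t := fun t => by simp only [ha]; positivity
  have hac : Continuous a := continuous_iff_continuousAt.2 fun t => (hD' t).continuousAt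
  -- Integrating the virial inequality, `b` outgrows every bound since `∫ a` is finite.
  have hmono : MonotoneOn (fun t => b t - c / 2 * t + (10 + ℓ) * ∫ s in t₀..t, a s)
      (Set.Ici t₀) := by
    have hd : ∀ t, HasDerivAt (fun t => b t - c / 2 * t + (10 + ℓ) * ∫ s in t₀..t, a s)
        (D t - c / 2 * 1 + (10 + ℓ) * a t) t := fun t =>
      ((hD t).sub ((hasDerivAt_id t).const_mul (c / 2))).add
        ((intervalIntegral.integral_hasDerivAt_right (hac.intervalIntegrable _ _)
          (hac.stronglyMeasurableAtFilter _ _) hac.continuousAt).const_mul (10 + ℓ))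
    refine monotoneOn_of_deriv_nonneg (convex_Ici t₀)
      (fun t _ => (hd t).continuousAt.continuousWithinAt)
      (fun t _ => (hd t).differentiableAt.differentiableWithinAt) fun t ht => ?_
    rw [(hd t).deriv]
    rw [interior_Ici] at ht
    have h1 := hcE t (le_of_lt ht)
    have h2 := hDge t
    linarith
  set I := ∫ s, a s
  have hbI : ∀ t ≥ t₀, b t₀ + c / 2 * (t - t₀) - (10 + ℓ) * I ≤ b t := fun t ht => by
    have h1 := hmono Set.self_mem_Ici ht ht
    simp only [intervalIntegral.integral_same] at h1
    have h2 : ∫ s in t₀..t, a s ≤ I := by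
      rw [intervalIntegral.integral_of_le ht]
      exact setIntegral_le_integral hint (ae_of_all _ ha0)
    have h3 := mul_le_mul_of_nonneg_left h2 (show 0 ≤ 10 + ℓ by linarith)
    linarith
  obtain ⟨T, hT0, hT⟩ : ∃ T ≥ t₀, ∀ t ≥ T, 1 ≤ b t := by
    refine ⟨max t₀ (t₀ + (1 - b t₀ + (10 + ℓ) * I) / (c / 2)), le_max_left _ _, fun t ht => ?_⟩
    have h1 := hbI t ((le_max_left _ _).trans ht)
    have h2 := (le_max_right _ _).trans ht
    have h3 : (1 - b t₀ + (10 + ℓ) * I) / (c / 2) ≤ t - t₀ := by linarith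
    rw [div_le_iff₀ (by positivity)] at h3
    linarith
  have hmono' : MonotoneOn (fun t => a t - 2 * t) (Set.Ici T) := by
    have hd : ∀ t, HasDerivAt (fun t => a t - 2 * t) (D' t - 2 * 1) t := fun t =>
      (hD' t).sub ((hasDerivAt_id t).const_mul 2)
    refine monotoneOn_of_deriv_nonneg (convex_Ici T)
      (fun t _ => (hd t).continuousAt.continuousWithinAt)
      (fun t _ => (hd t).differentiableAt.differentiableWithinAt) fun t ht => ?_
    rw [(hd t).deriv]
    rw [interior_Ici] at ht
    have h1 := hT t (le_of_lt ht)
    have h2 := hDge' t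
    simp only [hb] at h1
    linarith
  have ha1 : ∀ t ∈ Set.Ioi (T + 1), ‖(1 : ℝ)‖ ≤ a t := fun t ht => by
    have ht' : T + 1 < t := ht
    have h1 := hmono' Set.self_mem_Ici (show t ∈ Set.Ici T from by
      simp only [Set.mem_Ici]; linarith) (by linarith)
    simp only at h1
    rw [norm_one]
    linarith [ha0 T]
  have hfin : IntegrableOn (fun _ : ℝ => (1 : ℝ)) (Set.Ioi (T + 1)) :=
    Integrable.mono' hint.integrableOn aestronglyMeasurable_const
      ((ae_restrict_iff' measurableSet_Ioi).2 (ae_of_all _ ha1))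
  simp [integrableOn_const_iff] at hfin

end Growth

/-! ### Polar coordinates at the positive x-axis -/

section Polar

variable {F : Type*} [NormedAddCommGroup F] [NormedSpace ℝ F]
  {v : EuclideanSpace ℝ (Fin 2) → F}

/-- The point `(eᵗ, 0)` of the plane. -/
noncomputable def axisPoint (t : ℝ) : EuclideanSpace ℝ (Fin 2) :=
  Real.exp t • EuclideanSpace.single 0 1

lemma axisPoint_zero (t : ℝ) : axisPoint t 0 = Real.exp t := by simp [axisPoint]

lemma axisPoint_one (t : ℝ) : axisPoint t 1 = 0 := by simp [axisPoint]

lemma norm_axisPoint (t : ℝ) : ‖axisPoint t‖ = Real.exp t := by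
  simp [axisPoint, norm_smul]

lemma hasDerivAt_axisPoint (t : ℝ) : HasDerivAt axisPoint (axisPoint t) t :=
  (Real.hasDerivAt_exp t).smul_const _

/-- The point with polar coordinates `(r, θ)`. -/
noncomputable def polarPoint (r θ : ℝ) : EuclideanSpace ℝ (Fin 2) :=
  !₂[r * Real.cos θ, r * Real.sin θ]

lemma polarPoint_eq (r θ : ℝ) : polarPoint r θ = (r * Real.cos θ) • EuclideanSpace.single 0 1 +
    (r * Real.sin θ) • EuclideanSpace.single 1 1 := by
  ext i; fin_cases i <;> simp [polarPoint]

lemma polarPoint_exp_zero (t : ℝ) : polarPoint (Real.exp t) 0 = axisPoint t := by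
  simp [polarPoint_eq, axisPoint]

lemma norm_polarPoint {r : ℝ} (hr : 0 ≤ r) (θ : ℝ) : ‖polarPoint r θ‖ = r := by
  rw [EuclideanSpace.norm_eq, Real.sqrt_eq_iff_eq_sq (by positivity) hr]
  simp only [polarPoint, Fin.sum_univ_two, Real.norm_eq_abs, sq_abs]
  simp only [Matrix.cons_val_zero, Matrix.cons_val_one]
  linear_combination r ^ 2 * Real.cos_sq_add_sin_sq θ

lemma exists_eq_polarPoint (p : EuclideanSpace ℝ (Fin 2)) : ∃ θ, p = polarPoint ‖p‖ θ := by
  have hn : ‖(⟨p 0, p 1⟩ : ℂ)‖ = ‖p‖ := by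
    rw [EuclideanSpace.norm_eq, Complex.norm_eq_sqrt_sq_add_sq]
    simp [Fin.sum_univ_two]
  refine ⟨Complex.arg ⟨p 0, p 1⟩, ?_⟩
  ext i
  fin_cases i
  · simpa [polarPoint, hn] using (Complex.norm_mul_cos_arg ⟨p 0, p 1⟩).symm
  · simpa [polarPoint, hn] using (Complex.norm_mul_sin_arg ⟨p 0, p 1⟩).symm

lemma hasDerivAt_polarPoint (r θ : ℝ) :
    HasDerivAt (polarPoint r) (polarPoint r (θ + Real.pi / 2)) θ := by
  have h : HasDerivAt (fun s => (r * Real.cos s) • EuclideanSpace.single (0 : Fin 2) (1 : ℝ) +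
    (r * Real.sin s) • EuclideanSpace.single (1 : Fin 2) (1 : ℝ)) _ θ :=
    ((((Real.hasDerivAt_cos θ).const_mul r).smul_const _).add
    (((Real.hasDerivAt_sin θ).const_mul r).smul_const _))
  rw [show polarPoint r = _ from funext (polarPoint_eq r)]
  refine h.congr_deriv ?_
  simp only [Real.cos_add_pi_div_two, Real.sin_add_pi_div_two, mul_neg]

lemma polarPoint_exp_pi_div_two (t : ℝ) :
    polarPoint (Real.exp t) (Real.pi / 2) = Real.exp t • EuclideanSpace.single 1 1 := by
  simp [polarPoint_eq]

lemma polarPoint_exp_pi (t : ℝ) : polarPoint (Real.exp t) Real.pi = -axisPoint t := by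
  simp [polarPoint_eq, axisPoint]

/-- The logarithmic radial derivative `r ∂ᵣ v` at the point `(eᵗ, 0)`. -/
noncomputable def radialDeriv (v : EuclideanSpace ℝ (Fin 2) → F) (t : ℝ) : F :=
  Real.exp t • partialDeriv 0 v (axisPoint t)

lemma fderiv_axisPoint (v : EuclideanSpace ℝ (Fin 2) → F) (t : ℝ) :
    fderiv ℝ v (axisPoint t) (axisPoint t) = radialDeriv v t := by
  conv_lhs => rw [axisPoint, map_smul]
  rfl

lemma hasDerivAt_comp_axisPoint {t : ℝ} (hv : DifferentiableAt ℝ v (axisPoint t)) :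
    HasDerivAt (fun s => v (axisPoint s)) (radialDeriv v t) t := by
  rw [← fderiv_axisPoint]
  exact hv.hasFDerivAt.comp_hasDerivAt t (hasDerivAt_axisPoint t)

lemma exp_smul_partialDeriv_one {t : ℝ} {V : F} (hv : DifferentiableAt ℝ v (axisPoint t))
    (hV : HasDerivAt (fun θ => v (polarPoint (Real.exp t) θ)) V 0) :
    Real.exp t • partialDeriv 1 v (axisPoint t) = V := by
  rw [← polarPoint_exp_zero] at hv
  have h := hv.hasFDerivAt.comp_hasDerivAt (0 : ℝ) (hasDerivAt_polarPoint (Real.exp t) 0)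
  rw [zero_add, polarPoint_exp_pi_div_two, map_smul, polarPoint_exp_zero] at h
  exact h.unique hV

/-- The Laplacian in the coordinates `(t, θ)`, `r = eᵗ`: since `e²ᵗ Δ = ∂ₜ² + ∂_θ²`, the second
radial derivative is `e²ᵗ Δ v` minus the second angular one. -/
lemma hasDerivAt_radialDeriv (hv : ContDiff ℝ 2 v) (t : ℝ) {V : ℝ → F} {V' : F}
    (hV : ∀ θ, HasDerivAt (fun θ => v (polarPoint (Real.exp t) θ)) (V θ) θ)
    (hV' : HasDerivAt V V' 0) :
    HasDerivAt (radialDeriv v) (Real.exp t ^ 2 • Δ v (axisPoint t) - V') t := by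
  have hd : Differentiable ℝ v := hv.differentiable (by norm_num)
  have hd' : Differentiable ℝ (fderiv ℝ v) :=
    (hv.fderiv_right (m := 1) (by norm_num)).differentiable (by norm_num)
  have h1 : HasDerivAt (fun s => fderiv ℝ v (axisPoint s) (axisPoint s)) _ t :=
    ((hd' (axisPoint t)).hasFDerivAt.comp_hasDerivAt t (hasDerivAt_axisPoint t)).clm_apply
      (hasDerivAt_axisPoint t)
  have h2 : HasDerivAt (fun θ => fderiv ℝ v (polarPoint (Real.exp t) θ)
      (polarPoint (Real.exp t) (θ + Real.pi / 2))) _ 0 :=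
    ((hd' (polarPoint (Real.exp t) 0)).hasFDerivAt.comp_hasDerivAt (0 : ℝ)
      (hasDerivAt_polarPoint (Real.exp t) 0)).clm_apply
      ((hasDerivAt_polarPoint (Real.exp t) (0 + Real.pi / 2)).comp_add_const 0 (Real.pi / 2))
  have h3 : V = fun θ => fderiv ℝ v (polarPoint (Real.exp t) θ)
      (polarPoint (Real.exp t) (θ + Real.pi / 2)) := funext fun θ => (hV θ).unique
    ((hd _).hasFDerivAt.comp_hasDerivAt θ (hasDerivAt_polarPoint (Real.exp t) θ))
  rw [h3] at hV'
  have h4 := h2.unique hV'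
  simp only [Function.comp_apply, zero_add, add_halves, polarPoint_exp_pi_div_two,
    polarPoint_exp_zero, polarPoint_exp_pi, map_neg, map_smul,
    smul_apply] at h4
  have h5 : radialDeriv v = fun s => fderiv ℝ v (axisPoint s) (axisPoint s) :=
    funext fun s => (fderiv_axisPoint v s).symm
  rw [h5]
  refine h1.congr_deriv ?_
  have h6 : fderiv ℝ (fderiv ℝ v) (axisPoint t) (axisPoint t) (axisPoint t) = Real.exp t ^ 2 •
      fderiv ℝ (fderiv ℝ v) (axisPoint t) (EuclideanSpace.single 0 1)
        (EuclideanSpace.single 0 1) := by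
    have (B : EuclideanSpace ℝ (Fin 2) →L[ℝ] EuclideanSpace ℝ (Fin 2) →L[ℝ] F) :
        B (axisPoint t) (axisPoint t) = Real.exp t ^ 2 •
          B (EuclideanSpace.single 0 1) (EuclideanSpace.single 0 1) := by
      rw [axisPoint, map_smul, map_smul, smul_apply, smul_smul, sq]
    exact this _
  rw [InnerProductSpace.laplacian_eq_iteratedFDeriv_orthonormalBasis v
    (EuclideanSpace.basisFun (Fin 2) ℝ)]
  simp only [Fin.sum_univ_two, iteratedFDeriv_two_apply, EuclideanSpace.basisFun_apply,
    Matrix.cons_val_zero, Matrix.cons_val_one, smul_add]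
  rw [← h4, h6, sq, mul_smul, mul_smul]
  abel

end Polar

/-! ### From the eigenvalue equation to the profile system -/

section Corotational

variable {𝕜 : Type*} [RCLike 𝕜] {w : EuclideanSpace ℝ (Fin 2) → EuclideanSpace 𝕜 (Fin 3)}

lemma hasDerivAt_coord {c : ℝ → EuclideanSpace 𝕜 (Fin 3)} {c' : EuclideanSpace 𝕜 (Fin 3)} {t : ℝ}
    (h : HasDerivAt c c' t) (i : Fin 3) : HasDerivAt (fun s => c s i) (c' i) t :=
  (PiLp.proj (𝕜 := ℝ) 2 (fun _ : Fin 3 => 𝕜) i).hasFDerivAt.comp_hasDerivAt t h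

lemma HasDerivAt.rclike_ofReal {c : ℝ → ℝ} {c' t : ℝ} (h : HasDerivAt c c' t) :
    HasDerivAt (fun s => (c s : 𝕜)) (c' : 𝕜) t :=
  (RCLike.ofRealCLM (K := 𝕜)).hasFDerivAt.comp_hasDerivAt t h

lemma IsCorotational.apply_polarPoint (h : IsCorotational 1 w) (t θ : ℝ) :
    w (polarPoint (Real.exp t) θ) = Real.cos θ • !₂[w (axisPoint t) 0, 0, 0] +
      Real.sin θ • !₂[0, w (axisPoint t) 0, 0] + !₂[0, 0, w (axisPoint t) 2] := by
  obtain ⟨f, g, hfg⟩ := h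
  have h0 := hfg (Real.exp t) 0 (Real.exp_pos t)
  have h1 := hfg (Real.exp t) θ (Real.exp_pos t)
  change w (polarPoint _ _) = _ at h0 h1
  rw [polarPoint_exp_zero] at h0
  rw [h0, h1]
  ext i
  fin_cases i <;> simp [RCLike.real_smul_eq_coe_mul, mul_comm]

lemma IsCorotational.apply_axisPoint_one (h : IsCorotational 1 w) (t : ℝ) :
    w (axisPoint t) 1 = 0 := by
  have := h.apply_polarPoint t 0
  rw [polarPoint_exp_zero] at this
  rw [this]
  simp

lemma hasDerivAt_cos_smul_add_sin_smul {F : Type*} [NormedAddCommGroup F] [NormedSpace ℝ F]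
    (a b c : F) (θ : ℝ) : HasDerivAt (fun θ => Real.cos θ • a + Real.sin θ • b + c)
      (-Real.sin θ • a + Real.cos θ • b) θ :=
  (((Real.hasDerivAt_cos θ).smul_const a).add ((Real.hasDerivAt_sin θ).smul_const b)).add_const c

lemma IsCorotational.exp_smul_partialDeriv_one (h : IsCorotational 1 w) {t : ℝ}
    (hw : DifferentiableAt ℝ w (axisPoint t)) :
    Real.exp t • partialDeriv 1 w (axisPoint t) = !₂[0, w (axisPoint t) 0, 0] := by
  apply _root_.exp_smul_partialDeriv_one hw
  simp only [h.apply_polarPoint]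
  simpa using hasDerivAt_cos_smul_add_sin_smul !₂[w (axisPoint t) 0, 0, 0]
    !₂[0, w (axisPoint t) 0, 0] !₂[0, 0, w (axisPoint t) 2] 0

lemma IsCorotational.hasDerivAt_radialDeriv (h : IsCorotational 1 w) (hw : ContDiff ℝ 2 w) (t : ℝ) :
    HasDerivAt (radialDeriv w)
      (Real.exp t ^ 2 • Δ w (axisPoint t) + !₂[w (axisPoint t) 0, 0, 0]) t := by
  have h2 : HasDerivAt (fun θ => -Real.sin θ • !₂[w (axisPoint t) 0, 0, 0] +
      Real.cos θ • !₂[0, w (axisPoint t) 0, 0]) (-!₂[w (axisPoint t) 0, 0, 0]) 0 := by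
    refine HasDerivAt.congr_deriv (((Real.hasDerivAt_sin 0).neg.smul_const _).add
      ((Real.hasDerivAt_cos 0).smul_const _)) ?_
    simp
  rw [← sub_neg_eq_add]
  refine _root_.hasDerivAt_radialDeriv hw t (fun θ => ?_) h2
  simp only [h.apply_polarPoint]
  exact hasDerivAt_cos_smul_add_sin_smul _ _ _ θ

lemma IsCorotational.radialDeriv_one (h : IsCorotational 1 w) {t : ℝ}
    (hw : DifferentiableAt ℝ w (axisPoint t)) : radialDeriv w t 1 = 0 := by
  have h1 := hasDerivAt_coord (hasDerivAt_comp_axisPoint hw) 1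
  simp only [h.apply_axisPoint_one] at h1
  exact h1.unique (hasDerivAt_const t 0)

variable (𝕜) in
lemma isCorotational_degreeOneBubble : IsCorotational 1 (degreeOneBubble 𝕜) := by
  refine ⟨fun r => ((2 * r / (1 + r ^ 2) : ℝ) : 𝕜),
    fun r => (((r ^ 2 - 1) / (r ^ 2 + 1) : ℝ) : 𝕜), fun r θ hr => ?_⟩
  have hn : ‖(!₂[r * Real.cos θ, r * Real.sin θ] : EuclideanSpace ℝ (Fin 2))‖ = r :=
    norm_polarPoint hr.le θ
  rw [degreeOneBubble, hn]
  ext i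
  fin_cases i
  · simp only [Nat.cast_one, one_mul, ← RCLike.ofReal_mul]
    simp only [Fin.zero_eta, Matrix.cons_val_zero]
    congr 1
    ring
  · simp only [Nat.cast_one, one_mul, ← RCLike.ofReal_mul]
    simp only [Fin.mk_one, Matrix.cons_val_one, Matrix.cons_val_zero]
    congr 1
    ring
  · rfl

variable (𝕜) in
lemma differentiable_degreeOneBubble : Differentiable ℝ (degreeOneBubble 𝕜) := by
  have hof : Differentiable ℝ (fun x : ℝ => (x : 𝕜)) := RCLike.ofRealCLM.differentiable
  have hsq : Differentiable ℝ fun p : EuclideanSpace ℝ (Fin 2) => ‖p‖ ^ 2 :=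
    differentiable_id.norm_sq ℝ
  have hinv : Differentiable ℝ fun p : EuclideanSpace ℝ (Fin 2) => (1 + ‖p‖ ^ 2)⁻¹ :=
    (hsq.const_add 1).fun_inv fun p => by positivity
  have hcoord (i : Fin 2) : Differentiable ℝ fun p : EuclideanSpace ℝ (Fin 2) =>
      2 * p i / (1 + ‖p‖ ^ 2) := by
    simp only [div_eq_mul_inv]
    exact Differentiable.fun_mul (by fun_prop) hinv
  have hheight : Differentiable ℝ fun p : EuclideanSpace ℝ (Fin 2) =>
      (‖p‖ ^ 2 - 1) / (‖p‖ ^ 2 + 1) := by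
    simp only [div_eq_mul_inv, add_comm _ (1 : ℝ)]
    exact (hsq.sub_const 1).fun_mul hinv
  rw [differentiable_piLp 2]
  intro i
  fin_cases i
  · exact hof.comp (hcoord 0)
  · exact hof.comp (hcoord 1)
  · exact hof.comp hheight

/-- The function `t ↦ (e²ᵗ - 1) / (e²ᵗ + 1) = tanh t`: the height of the degree one bubble on the
circle of radius `eᵗ`. -/
noncomputable def bubbleHeight (t : ℝ) : ℝ := (Real.exp t ^ 2 - 1) / (Real.exp t ^ 2 + 1)

lemma hasDerivAt_bubbleProfile (t : ℝ) :
    HasDerivAt bubbleProfile (-(bubbleProfile t * bubbleHeight t)) t := by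
  have h : HasDerivAt bubbleProfile _ t := ((Real.hasDerivAt_exp t).const_mul 2).div
    ((hasDerivAt_exp_sq t).const_add 1) (by positivity)
  refine h.congr_deriv ?_
  rw [bubbleProfile, bubbleHeight]
  field_simp
  ring

lemma hasDerivAt_bubbleHeight (t : ℝ) : HasDerivAt bubbleHeight (bubbleProfile t ^ 2) t := by
  have h : HasDerivAt bubbleHeight _ t := ((hasDerivAt_exp_sq t).sub_const 1).div
    ((hasDerivAt_exp_sq t).add_const 1) (by positivity)
  refine h.congr_deriv ?_
  rw [bubbleProfile]
  field_simp
  ring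

lemma degreeOneBubble_axisPoint (t : ℝ) : degreeOneBubble 𝕜 (axisPoint t) =
    !₂[(bubbleProfile t : 𝕜), 0, (bubbleHeight t : 𝕜)] := by
  rw [degreeOneBubble, norm_axisPoint, axisPoint_zero, axisPoint_one]
  simp [bubbleProfile, bubbleHeight]

lemma radialDeriv_degreeOneBubble_zero (t : ℝ) : radialDeriv (degreeOneBubble 𝕜) t 0 =
    ((-(bubbleProfile t * bubbleHeight t) : ℝ) : 𝕜) := by
  have h := hasDerivAt_coord
    (hasDerivAt_comp_axisPoint (differentiable_degreeOneBubble 𝕜 (axisPoint t))) 0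
  simp only [degreeOneBubble_axisPoint] at h
  exact h.unique (hasDerivAt_bubbleProfile t).rclike_ofReal

lemma radialDeriv_degreeOneBubble_two (t : ℝ) : radialDeriv (degreeOneBubble 𝕜) t 2 =
    ((bubbleProfile t ^ 2 : ℝ) : 𝕜) := by
  have h := hasDerivAt_coord
    (hasDerivAt_comp_axisPoint (differentiable_degreeOneBubble 𝕜 (axisPoint t))) 2
  simp only [degreeOneBubble_axisPoint] at h
  exact h.unique (hasDerivAt_bubbleHeight t).rclike_ofReal

lemma cross_smul_smul (c : ℝ) (a b : EuclideanSpace 𝕜 (Fin 3)) :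
    cross (c • a) (c • b) = c ^ 2 • cross a b := by
  ext i
  fin_cases i <;> simp [cross, cross_apply, RCLike.real_smul_eq_coe_mul] <;> ring

/-- The eigenvalue equation at `(eᵗ, 0)`, multiplied by `e²ᵗ`. -/
lemma SolvesEigenvalueEquation.exp_sq_smul_laplacian {lam : 𝕜}
    (hs : SolvesEigenvalueEquation (degreeOneBubble 𝕜) lam w) (hc : IsCorotational 1 w)
    (hw : Differentiable ℝ w) (t : ℝ) :
    Real.exp t ^ 2 • Δ w (axisPoint t) =
      (2 : 𝕜) • (cross (radialDeriv w t) !₂[0, (bubbleProfile t : 𝕜), 0] +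
        cross (radialDeriv (degreeOneBubble 𝕜) t) !₂[0, w (axisPoint t) 0, 0])
      + (lam * (bubbleProfile t : 𝕜) ^ 2) • w (axisPoint t) := by
  have hu := (isCorotational_degreeOneBubble 𝕜).exp_smul_partialDeriv_one
    (differentiable_degreeOneBubble 𝕜 (axisPoint t))
  rw [degreeOneBubble_axisPoint] at hu
  have hu' : Real.exp t • partialDeriv 1 (degreeOneBubble 𝕜) (axisPoint t) =
    !₂[0, (bubbleProfile t : 𝕜), 0] := hu
  rw [hs (axisPoint t), ← hu', ← hc.exp_smul_partialDeriv_one (hw _), radialDeriv, radialDeriv,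
    cross_smul_smul, cross_smul_smul, norm_axisPoint, bubbleProfile]
  have : (1 + (Real.exp t : 𝕜) ^ 2) ≠ 0 := by
    have h : (1 + Real.exp t ^ 2 : ℝ) ≠ 0 := by positivity
    exact_mod_cast h
  ext i
  simp only [PiLp.add_apply, PiLp.smul_apply, smul_eq_mul, RCLike.real_smul_eq_coe_mul]
  push_cast
  field_simp
  ring

/-- The profiles of a co-rotational solution of the eigenvalue equation satisfy the profile
system. -/
theorem SolvesEigenvalueEquation.isProfileSystem {lam : 𝕜}
    (hs : SolvesEigenvalueEquation (degreeOneBubble 𝕜) lam w) (hc : IsCorotational 1 w)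
    (hw : ContDiff ℝ 2 w) :
    IsProfileSystem (fun x : 𝕜 => lam * x) (fun t => w (axisPoint t) 0)
      (fun t => radialDeriv w t 0) (fun t => w (axisPoint t) 2)
      (fun t => radialDeriv w t 2 - (2 * bubbleProfile t) • w (axisPoint t) 0) := by
  have hd : Differentiable ℝ w := hw.differentiable (by norm_num)
  have hF := fun t => hasDerivAt_comp_axisPoint (hd (axisPoint t))
  have hR := fun t => hc.hasDerivAt_radialDeriv hw t
  have hEq := hs.exp_sq_smul_laplacian hc hd
  refine ⟨fun t => hasDerivAt_coord (hF t) 0, fun t => ?_, fun t => ?_, fun t => ?_⟩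
  · refine (hasDerivAt_coord (hR t) 0).congr_deriv ?_
    rw [hEq t]
    simp only [cross, PiLp.add_apply, PiLp.smul_apply, cross_apply, smul_eq_mul,
      RCLike.real_smul_eq_coe_mul, Matrix.cons_val_zero, Matrix.cons_val_one, Matrix.cons_val,
      hc.radialDeriv_one (hd _), radialDeriv_degreeOneBubble_two]
    push_cast
    ring
  · refine (hasDerivAt_coord (hF t) 2).congr_deriv ?_
    simp
  · refine ((hasDerivAt_coord (hR t) 2).sub (((hasDerivAt_bubbleProfile t).const_mul 2).smul
      (hasDerivAt_coord (hF t) 0))).congr_deriv ?_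
    rw [hEq t]
    simp only [cross, PiLp.add_apply, PiLp.smul_apply, cross_apply, smul_eq_mul,
      RCLike.real_smul_eq_coe_mul, Matrix.cons_val_zero, Matrix.cons_val_one, Matrix.cons_val,
      radialDeriv_degreeOneBubble_zero]
    push_cast
    ring

/-! ### Square integrability in the logarithmic radius -/

lemma IsCorotational.norm_apply_polarPoint (h : IsCorotational 1 w) {r : ℝ} (hr : 0 < r) (θ : ℝ) :
    ‖w (polarPoint r θ)‖ ^ 2 =
      ‖w (axisPoint (Real.log r)) 0‖ ^ 2 + ‖w (axisPoint (Real.log r)) 2‖ ^ 2 := by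
  have h1 := h.apply_polarPoint (Real.log r) θ
  rw [Real.exp_log hr] at h1
  rw [h1, EuclideanSpace.norm_sq_eq]
  simp [Fin.sum_univ_three, norm_smul, mul_pow]
  rw [← add_mul, Real.cos_sq_add_sin_sq, one_mul]

open MeasureTheory in
/-- For a co-rotational `w` in `L²`, integration in polar coordinates with `r = eᵗ` gives
`∫ e²ᵗ (|f|² + |g|²) dt < ∞`. -/
lemma IsCorotational.integrable_of_memLp (h : IsCorotational 1 w) (hw : MemLp w 2) :
    Integrable fun t : ℝ =>
      Real.exp t ^ 2 * (‖w (axisPoint t) 0‖ ^ 2 + ‖w (axisPoint t) 2‖ ^ 2) := by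
  have h1 := (memLp_two_iff_integrable_sq_norm hw.1).1 hw
  have h2 : (fun p => ‖w p‖ ^ 2) = fun p => ‖w (polarPoint ‖p‖ 0)‖ ^ 2 := by
    ext p
    obtain ⟨θ, hθ⟩ := exists_eq_polarPoint p
    rcases eq_or_lt_of_le (norm_nonneg p) with h0 | h0
    · rw [norm_eq_zero.1 h0.symm]
      simp [polarPoint_eq]
    · conv_lhs => rw [hθ]
      rw [h.norm_apply_polarPoint h0, h.norm_apply_polarPoint h0]
  rw [h2, integrable_fun_norm_addHaar volume (f := fun r => ‖w (polarPoint r 0)‖ ^ 2),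
    ← Real.range_exp, ← Set.image_univ, integrableOn_image_iff_integrableOn_abs_deriv_smul
      MeasurableSet.univ (fun t _ => (Real.hasDerivAt_exp t).hasDerivWithinAt)
      Real.exp_injective.injOn, integrableOn_univ] at h1
  convert h1 using 2 with t
  rw [h.norm_apply_polarPoint (Real.exp_pos t), Real.log_exp]
  simp
  ring

end Corotational

theorem theorem1p2 {𝕜 : Type*} [RCLike 𝕜] :
    ¬ ∃ (lam : 𝕜) (w : EuclideanSpace ℝ (Fin 2) → EuclideanSpace 𝕜 (Fin 3)),
      IsEigenfunction (degreeOneBubble 𝕜) lam w ∧ IsCorotational 1 w := by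
  rintro ⟨lam, w, hw, hc⟩
  have hz := (hw.solves.isProfileSystem hc hw.contDiff).eq_zero_of_integrable
    (fun x => (norm_mul lam x).le) (norm_nonneg lam) (hc.integrable_of_memLp hw.memLp)
  refine hw.ne_zero (hw.contDiff.continuous.ext_on (dense_compl_singleton 0)
    continuous_const fun p hp => ?_)
  obtain ⟨θ, hθ⟩ := exists_eq_polarPoint p
  have h1 := hc.norm_apply_polarPoint (norm_pos_iff.2 hp) θ
  rw [← hθ, (hz _).1, (hz _).2] at h1
  simpa using h1
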